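/- A \emph{hypermap} is a pair $(\sigma,\alpha)$ of permutations of a finite set of points such that the group $\langle\sigma,\alpha\rangle$ has exactly one orbit. The cycles of $\sigma$ (including fixed points) are its vertices, the cycles of $\alpha$ its hyperedges, and the degree of a vertex is its number of points. Write $z(\pi)$ for the number of cycles of $\pi$, fixed points included. The genus $g(\sigma,\alpha)$ of a hypermap on $n$ points is defined by $$n+2-2g(\sigma,\alpha)=z(\sigma)+z(\alpha)+z(\alpha^{-1}\sigma).$$ A permutation $\theta$ is a \emph{refinement} of $\gamma$ if, for every cycle $\gamma_i$ of $\gamma$, $\theta$ maps the set of points of $\gamma_i$ to itself and its restriction $\theta_i$ to this set satisfies $g(\theta_i,\gamma_i)=0$. A \emph{spanning hypertree} of $(\sigma,\alpha)$ is a hypermap $(\sigma,\theta)$ such that $\theta$ is a refinement of $\alpha$, $z(\theta^{-1}\sigma)=1$ and $g(\sigma,\theta)=0$. The \emph{reciprocal} of $(\sigma,\alpha)$ is $(\alpha,\sigma)$. A \emph{map} is a hypermap all of whose hyperedges have at most two points. Its \emph{underlying graph} is the multigraph whose vertices are the cycles of $\sigma$ and whose edges are the cycles of $\alpha$, where each point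 of an edge contributes one end, namely the vertex containing that point. (Loops and multiple edges are allowed, and a one-point cycle of $\alpha$ is an edge with a single end.) An isomorphism of underlying graphs is a pair of bijections, between the vertices and between the edges, that preserves the multiset of ends of every edge. \textbf{Corollary.} Let $(\sigma_1,\alpha_1)$ and $(\sigma_2,\alpha_2)$ be maps all of whose vertices have degree at most $3$. If their underlying graphs are isomorphic, then the reciprocal hypermaps $(\alpha_1,\sigma_1)$ and $(\alpha_2,\sigma_2)$ have the same number of spanning hypertrees. In other words, for a map whose vertices have degree at most $3$, the number of spanning hypertrees of the reciprocal hypermap depends only on the underlying graph of the map, and not on its embedding. -/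

import Mathlib

/-- The cycles of a permutation `π`; a fixed point counts as a cycle with one point. -/
abbrev Cycles {Ω : Type*} (π : Equiv.Perm Ω) : Type _ :=
  Quotient (Equiv.Perm.SameCycle.setoid π)

/-- The cycle of `π` that contains the point `x`. -/
def cycleAt {Ω : Type*} (π : Equiv.Perm Ω) (x : Ω) : Cycles π :=
  Quotient.mk (Equiv.Perm.SameCycle.setoid π) x

/-- The points of a cycle of `π`. -/
abbrev CyclePoints {Ω : Type*} (π : Equiv.Perm Ω) (c : Cycles π) : Type _ :=
  {x : Ω // cycleAt π x = c}

/-- The length of a cycle: its number of points. -/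
noncomputable def cycleLength {Ω : Type*} (π : Equiv.Perm Ω) (c : Cycles π) : ℕ :=
  Nat.card (CyclePoints π c)

/-- `z(π)`: the number of cycles of `π`, fixed points included. -/
noncomputable def numCycles {Ω : Type*} (π : Equiv.Perm Ω) : ℕ :=
  Nat.card (Cycles π)

theorem cycleAt_apply {Ω : Type*} (π : Equiv.Perm Ω) (x : Ω) :
    cycleAt π (π x) = cycleAt π x :=
  Quotient.sound (s := Equiv.Perm.SameCycle.setoid π)
    (show π.SameCycle (π x) x from
      Equiv.Perm.sameCycle_apply_left.2 (Equiv.Perm.SameCycle.refl π x))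

/-- A collection of hypermaps `(σ, α)` on the point set `Ω`. The cycles of `σ` are the vertices,
the cycles of `α` are the hyperedges. -/
structure HypermapCollection (Ω : Type*) where
  σ : Equiv.Perm Ω
  α : Equiv.Perm Ω

namespace HypermapCollection

/-- `κ(σ, α)`: the number of orbits of the permutation group generated by `σ` and `α`. -/
noncomputable def numComponents {Ω : Type*} (H : HypermapCollection Ω) : ℕ :=
  Nat.card (MulAction.orbitRel.Quotient
    (Subgroup.closure ({H.σ, H.α} : Set (Equiv.Perm Ω))) Ω)

/-- A hypermap is a collection of hypermaps with exactly one connected component. -/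
def IsHypermap {Ω : Type*} (H : HypermapCollection Ω) : Prop :=
  H.numComponents = 1

/-- The faces are the cycles of `α⁻¹ σ`. -/
def facePerm {Ω : Type*} (H : HypermapCollection Ω) : Equiv.Perm Ω :=
  H.α⁻¹ * H.σ

/-- The genus of a (connected) hypermap on `n` points, given by
`n + 2 - 2 g = z(σ) + z(α) + z(α⁻¹ σ)`. It is only used for connected hypermaps. -/
noncomputable def genus {Ω : Type*} (H : HypermapCollection Ω) : ℚ :=
  ((Nat.card Ω : ℚ) + 2 - (numCycles H.σ + numCycles H.α + numCycles H.facePerm)) / 2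

/-- The reciprocal of `(σ, α)` is `(α, σ)`. -/
def reciprocal {Ω : Type*} (H : HypermapCollection Ω) : HypermapCollection Ω where
  σ := H.α
  α := H.σ

/-- A map is a hypermap each of whose hyperedges has at most two points. -/
def IsMap {Ω : Type*} (H : HypermapCollection Ω) : Prop :=
  H.IsHypermap ∧ ∀ e : Cycles H.α, cycleLength H.α e ≤ 2

/-- The degree of a vertex is its number of points. -/
noncomputable def degree {Ω : Type*} (H : HypermapCollection Ω) (v : Cycles H.σ) : ℕ :=
  cycleLength H.σ v

end HypermapCollection

/-- `θ` is a refinement of `γ`: for every cycle `γᵢ` of `γ`, the permutation `θ` maps the points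
of `γᵢ` to themselves, and its restriction `θᵢ` to these points satisfies `g(θᵢ, γᵢ) = 0`. -/
def IsRefinement {Ω : Type*} (θ γ : Equiv.Perm Ω) : Prop :=
  ∀ c : Cycles γ, ∃ h : ∀ x, cycleAt γ (θ x) = c ↔ cycleAt γ x = c,
    HypermapCollection.genus (Ω := CyclePoints γ c)
      ⟨θ.subtypePerm h, γ.subtypePerm fun x => by rw [cycleAt_apply]⟩ = 0

namespace HypermapCollection

/-- `(σ, θ)` is a spanning hypertree of `(σ, α)`: `θ` refines `α`, and `(σ, θ)` is a
unicellular hypermap of genus zero. -/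
def IsSpanningHypertree {Ω : Type*} (H : HypermapCollection Ω) (θ : Equiv.Perm Ω) : Prop :=
  IsRefinement θ H.α ∧
    (⟨H.σ, θ⟩ : HypermapCollection Ω).IsHypermap ∧
    numCycles (⟨H.σ, θ⟩ : HypermapCollection Ω).facePerm = 1 ∧
    (⟨H.σ, θ⟩ : HypermapCollection Ω).genus = 0

/-- The number of spanning hypertrees. -/
noncomputable def numSpanningHypertrees {Ω : Type*} (H : HypermapCollection Ω) : ℕ :=
  Nat.card {θ : Equiv.Perm Ω // H.IsSpanningHypertree θ}

end HypermapCollection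

/-- A multigraph with vertices `V` and edges `E`, given by the multiset of end vertices of each
edge. A link has two distinct ends, a loop has one end with multiplicity two, and a bud
(half-edge) has a single end with multiplicity one. -/
structure IncidenceGraph (V E : Type*) where
  ends : E → Multiset V

/-- An isomorphism of multigraphs: bijections between the vertices and between the edges that
respect the ends of every edge, with multiplicities. -/
structure IncidenceGraph.Iso {V E V' E' : Type*}
    (G : IncidenceGraph V E) (G' : IncidenceGraph V' E') where
  vertexEquiv : V ≃ V'
  edgeEquiv : E ≃ E'
  map_ends : ∀ e : E, (G.ends e).map vertexEquiv = G'.ends (edgeEquiv e)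

open Classical in
/-- The underlying graph of `(σ, α)`: its vertices are the cycles of `σ`, its edges are the cycles
of `α`, and each point of an edge contributes one end, namely the vertex containing that point.
The cyclic orders of the points in the cycles are forgotten. -/
noncomputable def HypermapCollection.underlyingGraph {Ω : Type*} [Fintype Ω]
    (H : HypermapCollection Ω) : IncidenceGraph (Cycles H.σ) (Cycles H.α) where
  ends e := (Finset.univ.filter fun x : Ω => cycleAt H.α x = e).val.map (cycleAt H.σ)

/-! A spanning hypertree of the reciprocal refines the vertex permutation, whose cycles have at most
three points. Every partition of at most three points on a circle is noncrossing, and on such a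
cycle a genus-zero `θ` is an involution or the cycle itself; only the inverse of a 3-cycle is
excluded (`isRefinement_iff`). Hence, once the cycle is given, `θ` is determined by its orbits as
sets.

The hypertree condition also sees only orbits. For a connected pair, "unicellular of genus zero"
amounts to n + 1 = z(σ) + z(θ), which says that the bipartite incidence graph of the cycles is a
tree; a tree has a single face whatever the cyclic orders (`numCycles_facePerm_eq_one`).

A graph isomorphism lifts to a bijection of points respecting the cycles of both permutations as
sets (`exists_preservesCycles_of_iso`). Conjugating `θ` by it where `θ` is involutive, and replacing
one 3-cycle by the other elsewhere, gives a bijection between the hypertrees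
(`IsSmallRefinement.transfer`). -/

open Equiv.Perm

/-! ### Cycles and the functions constant on them -/

theorem cycleAt_eq_iff {Ω : Type*} {π : Equiv.Perm Ω} {x y : Ω} :
    cycleAt π x = cycleAt π y ↔ SameCycle π x y :=
  Quotient.eq (r := SameCycle.setoid π)

theorem cycleAt_surjective {Ω : Type*} (π : Equiv.Perm Ω) : Function.Surjective (cycleAt π) :=
  Quotient.mk_surjective

theorem eq_of_sameCycle_of_invariant {Ω β : Type*} {π : Equiv.Perm Ω} {g : Ω → β}
    (hg : ∀ x, g (π x) = g x) {x y : Ω} (h : SameCycle π x y) : g x = g y := by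
  obtain ⟨i, rfl⟩ := h
  induction i using Int.induction_on generalizing x with
  | zero => simp
  | succ i ih => rw [zpow_add_one, mul_apply, ← ih, hg]
  | pred i ih => rw [zpow_sub_one, mul_apply, ← ih, ← hg (π⁻¹ x)]; simp

theorem numCycles_eq_of_sameCycle_iff {Ω₁ Ω₂ : Type*} {π₁ : Equiv.Perm Ω₁} {π₂ : Equiv.Perm Ω₂}
    (f : Ω₁ ≃ Ω₂) (h : ∀ x y, SameCycle π₁ x y ↔ SameCycle π₂ (f x) (f y)) :
    numCycles π₁ = numCycles π₂ :=
  Nat.card_congr (Quotient.congr f h)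

theorem sameCycle_permCongr {Ω₁ Ω₂ : Type*} (e : Ω₁ ≃ Ω₂) (π : Equiv.Perm Ω₁) (x y : Ω₁) :
    SameCycle π x y ↔ SameCycle (e.permCongr π) (e x) (e y) := by
  have key : ∀ i : ℤ, (e.permCongr π ^ i) (e x) = e ((π ^ i) x) := by
    intro i
    have : e.permCongr π ^ i = e.permCongr (π ^ i) :=
      (map_zpow (e.permCongrHom) π i).symm
    rw [this, Equiv.permCongr_apply, Equiv.symm_apply_apply]
  simp only [SameCycle, key, e.injective.eq_iff]

/-- The functions that are constant on the cycles of `π`. -/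
def invariantFunctions {Ω : Type*} (π : Equiv.Perm Ω) : Submodule ℚ (Ω → ℚ) where
  carrier := {v | ∀ x, v (π x) = v x}
  add_mem' ha hb x := by simp [ha x, hb x]
  zero_mem' _ := rfl
  smul_mem' c v h x := by simp [h x]

theorem mem_invariantFunctions {Ω : Type*} {π : Equiv.Perm Ω} {v : Ω → ℚ} :
    v ∈ invariantFunctions π ↔ ∀ x, v (π x) = v x := Iff.rfl

/-- Functions on the set of cycles are the functions constant on cycles. -/
def cyclesFunEquiv {Ω : Type*} (π : Equiv.Perm Ω) :
    (Cycles π → ℚ) ≃ₗ[ℚ] invariantFunctions π where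
  toFun u := ⟨fun x => u (cycleAt π x), fun x => by simp only [cycleAt_apply]⟩
  map_add' _ _ := rfl
  map_smul' _ _ := rfl
  invFun v := Quotient.lift v.1 fun _ _ h => eq_of_sameCycle_of_invariant v.2 h
  left_inv u := by
    funext c
    obtain ⟨x, rfl⟩ := cycleAt_surjective π c
    rfl
  right_inv v := rfl

theorem finrank_invariantFunctions {Ω : Type*} [Finite Ω] (π : Equiv.Perm Ω) :
    Module.finrank ℚ (invariantFunctions π) = numCycles π := by
  have : Finite (Cycles π) := Quotient.finite _
  have := Fintype.ofFinite (Cycles π)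
  rw [← (cyclesFunEquiv π).finrank_eq, Module.finrank_fintype_fun_eq_card, numCycles,
    Nat.card_eq_fintype_card]

theorem numCycles_eq_one {Ω : Type*} [Nonempty Ω] {π : Equiv.Perm Ω}
    (h : ∀ v : Ω → ℚ, (∀ x, v (π x) = v x) → ∀ x y, v x = v y) : numCycles π = 1 := by
  classical
  refine Nat.card_eq_one_iff_unique.2 ⟨⟨fun c d => ?_⟩, ‹Nonempty Ω›.map (cycleAt π)⟩
  obtain ⟨x, rfl⟩ := cycleAt_surjective π c
  obtain ⟨y, rfl⟩ := cycleAt_surjective π d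
  by_contra hne
  have := h (fun z => if cycleAt π z = cycleAt π x then 1 else 0)
    (fun z => by simp only [cycleAt_apply]) x y
  simp [Ne.symm hne] at this

/-! ### Connectivity, and why trees are unicellular -/

namespace HypermapCollection

/-- Testing connectivity on rational functions makes it usable in linear algebra. Nonemptiness is
separate because the empty set has no orbit. -/
theorem isHypermap_iff {Ω : Type*} (H : HypermapCollection Ω) :
    H.IsHypermap ↔ Nonempty Ω ∧ ∀ v : Ω → ℚ, (∀ x, v (H.σ x) = v x) → (∀ x, v (H.α x) = v x) →
      ∀ x y, v x = v y := by
  classical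
  unfold IsHypermap numComponents
  rw [Nat.card_eq_one_iff_unique]
  set G := Subgroup.closure ({H.σ, H.α} : Set (Equiv.Perm Ω)) with hG
  have hσ : H.σ ∈ G := Subgroup.subset_closure (by simp)
  have hα : H.α ∈ G := Subgroup.subset_closure (by simp)
  constructor
  · rintro ⟨hs, ⟨q⟩⟩
    refine ⟨⟨q.out⟩, fun v h₁ h₂ x y => ?_⟩
    have hxy : (Quotient.mk (MulAction.orbitRel G Ω) x) = Quotient.mk _ y := Subsingleton.elim _ _
    obtain ⟨g, rfl⟩ := Quotient.exact hxy
    have key : ∀ g ∈ G, ∀ z, v (g z) = v z := by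
      intro g hg
      induction hg using Subgroup.closure_induction with
      | mem g hg =>
        rcases hg with rfl | rfl
        exacts [h₁, h₂]
      | one => simp
      | mul a b _ _ ha hb => intro z; rw [mul_apply, ha, hb]
      | inv a _ ha => intro z; rw [← ha (a⁻¹ z)]; simp
    exact key g.1 g.2 y
  · rintro ⟨⟨x₀⟩, h⟩
    refine ⟨⟨fun c d => ?_⟩, ⟨Quotient.mk _ x₀⟩⟩
    induction c using Quotient.inductionOn with | _ x
    induction d using Quotient.inductionOn with | _ y
    have hmk : ∀ g ∈ G, ∀ z, (Quotient.mk (MulAction.orbitRel G Ω) (g z)) = Quotient.mk _ z :=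
      fun g hg z => Quotient.sound ⟨⟨g, hg⟩, rfl⟩
    by_contra hne
    have := h (fun z => if (Quotient.mk (MulAction.orbitRel G Ω) z) = Quotient.mk _ x then 1 else 0)
      (fun z => by simp only [hmk _ hσ]) (fun z => by simp only [hmk _ hα]) x y
    simp [Ne.symm hne] at this

/-- A connected pair of permutations whose incidence graph is a tree is unicellular. -/
theorem numCycles_facePerm_eq_one {Ω : Type*} [Finite Ω] {H : HypermapCollection Ω}
    (hH : H.IsHypermap) (hcard : Nat.card Ω + 1 = numCycles H.σ + numCycles H.α) :
    numCycles H.facePerm = 1 := by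
  have := Fintype.ofFinite Ω
  obtain ⟨hne, hconst⟩ := H.isHypermap_iff.1 hH
  have hinf : Module.finrank ℚ
      (invariantFunctions H.σ ⊓ invariantFunctions H.α : Submodule ℚ (Ω → ℚ)) = 1 := by
    refine finrank_eq_one (⟨fun _ => 1, fun _ => rfl, fun _ => rfl⟩) ?_ fun w =>
      ⟨w.1 hne.some, Subtype.ext (funext fun x => ?_)⟩
    · intro h
      simpa using congrFun (congrArg Subtype.val h) hne.some
    · simpa using hconst w.1 w.2.1 w.2.2 hne.some x
  -- The invariant spaces have dimensions z(σ) and z(α) and meet in the constants, so the tree count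
  -- makes their sum the whole space.
  have htop : invariantFunctions H.σ ⊔ invariantFunctions H.α = ⊤ := by
    apply Submodule.eq_top_of_finrank_eq
    have := Submodule.finrank_sup_add_finrank_inf_eq
      (invariantFunctions H.σ) (invariantFunctions H.α)
    rw [hinf, finrank_invariantFunctions, finrank_invariantFunctions] at this
    rw [Module.finrank_fintype_fun_eq_card, ← Nat.card_eq_fintype_card]
    omega
  -- The increment of any function along `π` sums to zero over each cycle of `π`.
  have orth : ∀ (π : Equiv.Perm Ω) (a w : Ω → ℚ), (∀ x, a (π x) = a x) →
      ∑ x, a x * (w (π x) - w x) = 0 := by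
    intro π a w ha
    simp only [mul_sub, Finset.sum_sub_distrib]
    rw [← Equiv.sum_comp π (fun x => a x * w x)]
    simp [ha]
  refine numCycles_eq_one fun v hv => ?_
  -- Shifting by `α⁻¹` turns invariance on faces into equality of the increments of `w` along `σ`
  -- and along `α`. Split as `a + b`, this common increment is orthogonal to both summands, hence to
  -- itself, and so vanishes.
  set w : Ω → ℚ := fun x => v (H.α⁻¹ x) with hw
  have hwσ : ∀ x, w (H.σ x) = w (H.α x) := fun x => by
    simpa [hw, facePerm] using hv x
  obtain ⟨a, ha, b, hb, hab⟩ := Submodule.mem_sup.1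
    (htop ▸ Submodule.mem_top : (fun x => w (H.σ x) - w x) ∈
      invariantFunctions H.σ ⊔ invariantFunctions H.α)
  have hsq : ∑ x, (w (H.σ x) - w x) * (w (H.σ x) - w x) = 0 := by
    have h₁ := orth H.σ a w ha
    have h₂ := orth H.α b w hb
    simp only [← hwσ] at h₂
    rw [← add_zero (0 : ℚ)]
    nth_rewrite 1 [← h₁]
    rw [← h₂, ← Finset.sum_add_distrib]
    refine Finset.sum_congr rfl fun x _ => ?_
    rw [← add_mul]
    congr 1
    exact (congrFun hab x).symm
  have hfix : ∀ x, w (H.σ x) = w x := fun x => by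
    have := (Finset.sum_eq_zero_iff_of_nonneg fun x _ => mul_self_nonneg _).1 hsq x
      (Finset.mem_univ x)
    exact sub_eq_zero.1 (mul_self_eq_zero.1 this)
  have hw_const := hconst w hfix fun x => by rw [← hwσ, hfix]
  intro x y
  simpa [hw] using hw_const (H.α x) (H.α y)

end HypermapCollection

/-! ### Genus-zero refinements of cycles of length at most three -/

instance fintypeCyclesFin (k : ℕ) (π : Equiv.Perm (Fin k)) : Fintype (Cycles π) :=
  @Quotient.fintype _ _ (SameCycle.setoid π)
    (inferInstanceAs (DecidableRel (SameCycle π)))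

/-- The equation is genus zero with denominators cleared, checked exhaustively. Positivity of `k`
matters: on no points the count fails while the right side is vacuous. -/
theorem card_cycles_iff_of_fin {k : ℕ} (h0 : 0 < k) (hk : k ≤ 3) (γ θ : Equiv.Perm (Fin k)) :
    (∀ x y, SameCycle γ x y) →
    (k + 2 = Fintype.card (Cycles θ) + Fintype.card (Cycles γ) + Fintype.card (Cycles (γ⁻¹ * θ)) ↔
      ∀ x, θ (θ x) = x ∨ θ x = γ x) := by
  revert γ θ
  interval_cases k <;> decide +kernel

theorem genus_eq_zero_iff_of_card_le_three {X : Type*} [Finite X] [Nonempty X]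
    (hX : Nat.card X ≤ 3) {γ : Equiv.Perm X} (hγ : ∀ x y, SameCycle γ x y) (θ : Equiv.Perm X) :
    HypermapCollection.genus ⟨θ, γ⟩ = 0 ↔ ∀ x, θ (θ x) = x ∨ θ x = γ x := by
  let e := Finite.equivFin X
  have hcyc : ∀ π : Equiv.Perm X, numCycles π = Fintype.card (Cycles (e.permCongr π)) := fun π => by
    rw [numCycles_eq_of_sameCycle_iff e (sameCycle_permCongr e π), numCycles,
      Nat.card_eq_fintype_card]
  have key := card_cycles_iff_of_fin Nat.card_pos hX (e.permCongr γ) (e.permCongr θ)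
    fun x y => by
      simpa using (sameCycle_permCongr e γ (e.symm x) (e.symm y)).1 (hγ _ _)
  have hmul : (e.permCongr γ)⁻¹ * e.permCongr θ = e.permCongr (γ⁻¹ * θ) := by
    have := (map_mul e.permCongrHom γ⁻¹ θ).symm
    rwa [map_inv] at this
  rw [hmul, ← hcyc, ← hcyc, ← hcyc, e.symm.forall_congr_left] at key
  simp only [Equiv.permCongr_apply, Equiv.symm_symm, Equiv.symm_apply_apply,
    e.injective.eq_iff] at key
  rw [← key]
  simp only [HypermapCollection.genus, HypermapCollection.facePerm, div_eq_zero_iff, sub_eq_zero]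
  norm_num
  norm_cast

theorem isRefinement_iff {Ω : Type*} [Finite Ω] {γ : Equiv.Perm Ω}
    (hγ : ∀ c, cycleLength γ c ≤ 3) (θ : Equiv.Perm Ω) :
    IsRefinement θ γ ↔
      (∀ x, SameCycle γ (θ x) x) ∧ ∀ x, θ (θ x) = x ∨ θ x = γ x := by
  have hsame : ∀ (c : Cycles γ) (h : ∀ x, cycleAt γ (γ x) = c ↔ cycleAt γ x = c)
      (x y : CyclePoints γ c), SameCycle (γ.subtypePerm h) x y := fun c h x y =>
    sameCycle_subtypePerm.2 (cycleAt_eq_iff.1 (x.2.trans y.2.symm))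
  constructor
  · intro h
    constructor
    · intro x
      obtain ⟨hx, -⟩ := h (cycleAt γ x)
      exact cycleAt_eq_iff.1 ((hx x).2 rfl)
    · intro x
      obtain ⟨hx, hg⟩ := h (cycleAt γ x)
      have : Nonempty (CyclePoints γ (cycleAt γ x)) := ⟨⟨x, rfl⟩⟩
      have := (genus_eq_zero_iff_of_card_le_three (hγ _) (hsame _ _) _).1 hg ⟨x, rfl⟩
      simpa [Subtype.ext_iff] using this
  · rintro ⟨h₁, h₂⟩ c
    refine ⟨fun x => by rw [cycleAt_eq_iff.2 (h₁ x)], ?_⟩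
    obtain ⟨x, rfl⟩ := cycleAt_surjective γ c
    have : Nonempty (CyclePoints γ (cycleAt γ x)) := ⟨⟨x, rfl⟩⟩
    refine (genus_eq_zero_iff_of_card_le_three (hγ _) (hsame _ _) _).2 fun y => ?_
    simpa [Subtype.ext_iff] using h₂ y

theorem mem_of_sameCycle_of_cycleLength_le_three {Ω : Type*} [Finite Ω] {γ : Equiv.Perm Ω}
    {a b c d : Ω} (hγ : cycleLength γ (cycleAt γ a) ≤ 3) (hab : a ≠ b) (hac : a ≠ c) (hbc : b ≠ c)
    (hb : SameCycle γ a b) (hc : SameCycle γ a c) (hd : SameCycle γ a d) :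
    d = a ∨ d = b ∨ d = c := by
  classical
  by_contra! hne
  have := Fintype.ofFinite (CyclePoints γ (cycleAt γ a))
  let s : Finset (CyclePoints γ (cycleAt γ a)) :=
    {⟨a, rfl⟩, ⟨b, cycleAt_eq_iff.2 hb.symm⟩, ⟨c, cycleAt_eq_iff.2 hc.symm⟩,
      ⟨d, cycleAt_eq_iff.2 hd.symm⟩}
  have hs : s.card = 4 := by
    simp [s, Finset.card_insert_of_notMem, Subtype.ext_iff, hab, hac, hbc, hne.1.symm,
      hne.2.1.symm, hne.2.2.symm]
  have := s.card_le_univ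
  rw [cycleLength, Nat.card_eq_fintype_card] at hγ
  omega

theorem eq_or_eq_apply_of_apply_apply_eq {Ω : Type*} {π : Equiv.Perm Ω} {x y : Ω}
    (hx : π (π x) = x) (h : SameCycle π x y) : y = x ∨ y = π x := by
  have hset : ∀ z, (π z = x ∨ π z = π x) ↔ (z = x ∨ z = π x) := fun z => by
    rw [π.injective.eq_iff, or_comm]
    nth_rewrite 2 [← hx]
    rw [π.injective.eq_iff]
  have := eq_of_sameCycle_of_invariant (g := fun z => z = x ∨ z = π x)
    (fun z => propext (hset z)) h
  simpa using this

/-- With one face the genus formula becomes the tree count, and conversely the tree count forces one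
face. What remains of the tree condition mentions no cyclic order. -/
theorem HypermapCollection.isSpanningHypertree_iff {Ω : Type*} [Finite Ω]
    (H : HypermapCollection Ω) (hα : ∀ c, cycleLength H.α c ≤ 3) (θ : Equiv.Perm Ω) :
    H.IsSpanningHypertree θ ↔
      ((∀ x, SameCycle H.α (θ x) x) ∧ ∀ x, θ (θ x) = x ∨ θ x = H.α x) ∧
      (⟨H.σ, θ⟩ : HypermapCollection Ω).IsHypermap ∧
      Nat.card Ω + 1 = numCycles H.σ + numCycles θ := by
  rw [IsSpanningHypertree, isRefinement_iff hα]
  refine and_congr_right fun _ => and_congr_right fun hH => ?_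
  have hg : numCycles (⟨H.σ, θ⟩ : HypermapCollection Ω).facePerm = 1 →
      ((⟨H.σ, θ⟩ : HypermapCollection Ω).genus = 0 ↔
        Nat.card Ω + 1 = numCycles H.σ + numCycles θ) := fun h => by
    rw [genus, h, div_eq_zero_iff, or_iff_left (by norm_num), sub_eq_zero]
    norm_cast
    constructor <;> intro h' <;> simp only at * <;> omega
  constructor
  · rintro ⟨h₁, h₂⟩
    exact (hg h₁).1 h₂
  · intro h
    have h₁ := numCycles_facePerm_eq_one hH h
    exact ⟨h₁, (hg h₁).2 h⟩

/-! ### Transfer of refinements along a bijection of points -/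

/-- `f` carries the cycles of `π₁` to those of `π₂`, the cyclic orders being forgotten. -/
def PreservesCycles {Ω₁ Ω₂ : Type*} (f : Ω₁ ≃ Ω₂) (π₁ : Equiv.Perm Ω₁) (π₂ : Equiv.Perm Ω₂) :
    Prop :=
  ∀ x y, SameCycle π₁ x y ↔ SameCycle π₂ (f x) (f y)

theorem PreservesCycles.symm {Ω₁ Ω₂ : Type*} {f : Ω₁ ≃ Ω₂} {π₁ : Equiv.Perm Ω₁}
    {π₂ : Equiv.Perm Ω₂} (h : PreservesCycles f π₁ π₂) : PreservesCycles f.symm π₂ π₁ :=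
  fun x y => by simpa using (h (f.symm x) (f.symm y)).symm

theorem PreservesCycles.invariant {Ω₁ Ω₂ β : Type*} {f : Ω₁ ≃ Ω₂} {π₁ : Equiv.Perm Ω₁}
    {π₂ : Equiv.Perm Ω₂} (h : PreservesCycles f π₁ π₂) {v : Ω₂ → β} (hv : ∀ y, v (π₂ y) = v y)
    (x : Ω₁) : v (f (π₁ x)) = v (f x) :=
  eq_of_sameCycle_of_invariant hv ((h _ _).1 (sameCycle_apply_left.2 (SameCycle.refl _ _)))

theorem HypermapCollection.IsHypermap.of_preservesCycles {Ω₁ Ω₂ : Type*} {f : Ω₁ ≃ Ω₂}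
    {H₁ : HypermapCollection Ω₁} {H₂ : HypermapCollection Ω₂} (hσ : PreservesCycles f H₁.σ H₂.σ)
    (hα : PreservesCycles f H₁.α H₂.α) (h : H₁.IsHypermap) : H₂.IsHypermap := by
  obtain ⟨hne, hc⟩ := H₁.isHypermap_iff.1 h
  refine H₂.isHypermap_iff.2 ⟨hne.map f, fun v h₁ h₂ x y => ?_⟩
  simpa using hc (v ∘ f) (hσ.invariant h₁) (hα.invariant h₂) (f.symm x) (f.symm y)

/-- `θ` refines `γ` and is either an involution or equal to `γ` on each cycle of `γ`. -/
def IsSmallRefinement {Ω : Type*} (θ γ : Equiv.Perm Ω) : Prop :=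
  (∀ x, SameCycle γ (θ x) x) ∧ ∀ x, θ (θ x) = x ∨ θ x = γ x

namespace IsSmallRefinement

variable {Ω₁ Ω₂ : Type*} {θ γ₁ : Equiv.Perm Ω₁} {γ₂ : Equiv.Perm Ω₂} {f : Ω₁ ≃ Ω₂}

/-- Where `θ` is not involutive, the three points listed are distinct and so exhaust the cycle of
`γ₁`. -/
theorem mem_orbit [Finite Ω₁] (hθ : IsSmallRefinement θ γ₁) (hγ : ∀ c, cycleLength γ₁ c ≤ 3)
    {x y : Ω₁} (hx : θ (θ x) ≠ x) (h : SameCycle γ₁ x y) : y = x ∨ y = θ x ∨ y = θ (θ x) := by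
  have h₁ : θ x ≠ x := fun h => hx (by rw [h, h])
  exact mem_of_sameCycle_of_cycleLength_le_three (hγ _) h₁.symm hx.symm
    (fun h => h₁ (θ.injective h).symm) (hθ.1 x).symm
    ((hθ.1 x).symm.trans (hθ.1 (θ x)).symm) h

theorem apply_apply_ne [Finite Ω₁] (hθ : IsSmallRefinement θ γ₁) (hγ : ∀ c, cycleLength γ₁ c ≤ 3)
    {x y : Ω₁} (hx : θ (θ x) ≠ x) (h : SameCycle γ₁ x y) : θ (θ y) ≠ y := by
  rcases hθ.mem_orbit hγ hx h with rfl | rfl | rfl <;> simpa using hx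

open Classical in
/-- The small refinement of `γ₂` with the same cycles as `θ`, as a function. -/
noncomputable def transferFun (f : Ω₁ ≃ Ω₂) (γ₂ : Equiv.Perm Ω₂) (θ : Equiv.Perm Ω₁) (y : Ω₂) :
    Ω₂ :=
  if θ (θ (f.symm y)) = f.symm y then f (θ (f.symm y)) else γ₂ y

theorem transferFun_of_eq {x : Ω₁} (h : θ (θ x) = x) :
    transferFun f γ₂ θ (f x) = f (θ x) := by
  simp [transferFun, h]

theorem transferFun_of_ne {x : Ω₁} (h : θ (θ x) ≠ x) :
    transferFun f γ₂ θ (f x) = γ₂ (f x) := by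
  simp [transferFun, h]

theorem exists_apply_eq (hf : PreservesCycles f γ₁ γ₂) (x : Ω₁) :
    ∃ x', f x' = γ₂ (f x) ∧ SameCycle γ₁ x x' :=
  ⟨f.symm (γ₂ (f x)), by simp,
    (hf _ _).2 (by simpa using sameCycle_apply_right.2 (SameCycle.refl _ _))⟩

theorem transferFun_injective [Finite Ω₁] (hθ : IsSmallRefinement θ γ₁)
    (hγ : ∀ c, cycleLength γ₁ c ≤ 3) (hf : PreservesCycles f γ₁ γ₂) :
    Function.Injective (transferFun f γ₂ θ) := by
  -- The non-involutive points of `θ` form a union of cycles of `γ₁`, so images from the two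
  -- branches cannot collide.
  have mixed : ∀ x x', θ (θ x) = x → θ (θ x') ≠ x' →
      transferFun f γ₂ θ (f x) ≠ transferFun f γ₂ θ (f x') := by
    intro x x' h h' heq
    rw [transferFun_of_eq h, transferFun_of_ne h'] at heq
    obtain ⟨z, hz, hxz⟩ := exists_apply_eq hf x'
    rw [← hz, f.injective.eq_iff] at heq
    exact hθ.apply_apply_ne hγ h' (heq ▸ hxz) (by rw [h])
  intro y y' heq
  obtain ⟨x, rfl⟩ := f.surjective y
  obtain ⟨x', rfl⟩ := f.surjective y'
  by_cases h : θ (θ x) = x <;> by_cases h' : θ (θ x') = x'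
  · rw [transferFun_of_eq h, transferFun_of_eq h'] at heq
    rw [θ.injective (f.injective heq)]
  · exact absurd heq (mixed _ _ h h')
  · exact absurd heq.symm (mixed _ _ h' h)
  · rw [transferFun_of_ne h, transferFun_of_ne h'] at heq
    exact γ₂.injective heq

/-- The small refinement of `γ₂` with the same cycles as `θ`. -/
noncomputable def transfer [Finite Ω₁] [Finite Ω₂] (hθ : IsSmallRefinement θ γ₁)
    (hγ : ∀ c, cycleLength γ₁ c ≤ 3) (hf : PreservesCycles f γ₁ γ₂) : Equiv.Perm Ω₂ :=
  Equiv.ofBijective (transferFun f γ₂ θ)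
    (Finite.injective_iff_bijective.1 (hθ.transferFun_injective hγ hf))

section

variable [Finite Ω₁] [Finite Ω₂] (hθ : IsSmallRefinement θ γ₁)
  (hγ : ∀ c, cycleLength γ₁ c ≤ 3) (hf : PreservesCycles f γ₁ γ₂)

theorem transfer_of_eq {x : Ω₁} (h : θ (θ x) = x) : hθ.transfer hγ hf (f x) = f (θ x) :=
  transferFun_of_eq h

theorem transfer_of_ne {x : Ω₁} (h : θ (θ x) ≠ x) : hθ.transfer hγ hf (f x) = γ₂ (f x) :=
  transferFun_of_ne h

theorem transfer_transfer_eq_iff (x : Ω₁) :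
    hθ.transfer hγ hf (hθ.transfer hγ hf (f x)) = f x ↔ θ (θ x) = x := by
  constructor
  · intro h
    by_contra hx
    obtain ⟨z, hz, hxz⟩ := exists_apply_eq hf x
    rw [transfer_of_ne hθ hγ hf hx, ← hz,
      transfer_of_ne hθ hγ hf (hθ.apply_apply_ne hγ hx hxz), hz] at h
    -- If `γ₂` were involutive at `f x`, its cycle would have at most two points, yet it contains
    -- the images of the distinct points `x`, `θ x`, `θ (θ x)`.
    have mem := fun y (hy : SameCycle γ₁ x y) =>
      eq_or_eq_apply_of_apply_apply_eq h ((hf _ _).1 hy)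
    rw [← hz] at mem
    simp only [f.injective.eq_iff] at mem
    have h₁ : θ x ≠ x := fun h => hx (by rw [h, h])
    have e₁ := (mem _ (hθ.1 x).symm).resolve_left h₁
    have e₂ := (mem _ ((hθ.1 x).symm.trans (hθ.1 (θ x)).symm)).resolve_left hx
    exact h₁ (θ.injective (e₂.trans e₁.symm))
  · intro h
    rw [transfer_of_eq hθ hγ hf h, transfer_of_eq hθ hγ hf (by rw [h]), h]

theorem isSmallRefinement_transfer : IsSmallRefinement (hθ.transfer hγ hf) γ₂ := by
  constructor <;> intro y <;> obtain ⟨x, rfl⟩ := f.surjective y <;> by_cases h : θ (θ x) = x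
  · rw [transfer_of_eq hθ hγ hf h]
    exact (hf _ _).1 (hθ.1 x)
  · rw [transfer_of_ne hθ hγ hf h]
    exact sameCycle_apply_left.2 (SameCycle.refl _ _)
  · exact Or.inl ((hθ.transfer_transfer_eq_iff hγ hf x).2 h)
  · exact Or.inr (transfer_of_ne hθ hγ hf h)

theorem transfer_symm (hγ' : ∀ c, cycleLength γ₂ c ≤ 3) :
    (hθ.isSmallRefinement_transfer hγ hf).transfer hγ' hf.symm = θ := by
  ext x
  obtain ⟨y, rfl⟩ := f.symm.surjective x
  obtain ⟨x, rfl⟩ := f.surjective y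
  have key := hθ.transfer_transfer_eq_iff hγ hf x
  by_cases h : θ (θ x) = x
  · rw [transfer_of_eq _ hγ' hf.symm (key.2 h), transfer_of_eq hθ hγ hf h]
    simp
  · rw [transfer_of_ne _ hγ' hf.symm (fun h' => h (key.1 h'))]
    -- A non-involutive `θ` agrees with `γ₁`, so reinserting `γ₁` recovers it.
    simpa using ((hθ.2 x).resolve_left h).symm

theorem sameCycle_of_sameCycle_transfer {x y : Ω₁}
    (h : SameCycle (hθ.transfer hγ hf) (f x) (f y)) : SameCycle θ x y := by
  have := eq_of_sameCycle_of_invariant (g := fun z => cycleAt θ (f.symm z)) (fun z => ?_) h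
  · simpa using cycleAt_eq_iff.1 this
  · obtain ⟨x, rfl⟩ := f.surjective z
    rw [cycleAt_eq_iff]
    by_cases hx : θ (θ x) = x
    · rw [transfer_of_eq hθ hγ hf hx]
      simp [SameCycle.refl]
    · rw [transfer_of_ne hθ hγ hf hx]
      obtain ⟨z, hz, hxz⟩ := exists_apply_eq hf x
      rw [← hz]
      rcases hθ.mem_orbit hγ hx hxz with rfl | rfl | rfl <;> simp [SameCycle.refl]

theorem preservesCycles_transfer (hγ' : ∀ c, cycleLength γ₂ c ≤ 3) :
    PreservesCycles f θ (hθ.transfer hγ hf) := by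
  refine fun x y => ⟨fun h => ?_, hθ.sameCycle_of_sameCycle_transfer hγ hf⟩
  -- The missing implication is the proved one applied to the inverse transfer.
  rw [← hθ.transfer_symm hγ hf hγ'] at h
  exact (hθ.isSmallRefinement_transfer hγ hf).sameCycle_of_sameCycle_transfer hγ' hf.symm
    (by simpa using h)

end

end IsSmallRefinement

/-! ### Counting hypertrees and lifting graph isomorphisms -/

namespace HypermapCollection

theorem IsSpanningHypertree.transfer {Ω₁ Ω₂ : Type*} [Finite Ω₁] [Finite Ω₂] {f : Ω₁ ≃ Ω₂}
    {H₁ : HypermapCollection Ω₁} {H₂ : HypermapCollection Ω₂} {θ : Equiv.Perm Ω₁}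
    (h₁ : ∀ c, cycleLength H₁.α c ≤ 3) (h₂ : ∀ c, cycleLength H₂.α c ≤ 3)
    (hσ : PreservesCycles f H₁.σ H₂.σ) (hα : PreservesCycles f H₁.α H₂.α)
    (hr : IsSmallRefinement θ H₁.α) (h : H₁.IsSpanningHypertree θ) :
    H₂.IsSpanningHypertree (hr.transfer h₁ hα) := by
  obtain ⟨-, hc, hn⟩ := (H₁.isSpanningHypertree_iff h₁ θ).1 h
  have hp := hr.preservesCycles_transfer h₁ hα h₂
  refine (H₂.isSpanningHypertree_iff h₂ _).2
    ⟨hr.isSmallRefinement_transfer h₁ hα, hc.of_preservesCycles (H₁ := ⟨H₁.σ, θ⟩) (H₂ := ⟨H₂.σ, _⟩) hσ hp, ?_⟩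
  rwa [← numCycles_eq_of_sameCycle_iff f hσ, ← numCycles_eq_of_sameCycle_iff f hp,
    ← Nat.card_congr f]

/-- The number of spanning hypertrees of a hypermap with hyperedges of length at most three does
not depend on the cyclic orders. -/
theorem numSpanningHypertrees_eq_of_preservesCycles {Ω₁ Ω₂ : Type*} [Finite Ω₁] [Finite Ω₂]
    {f : Ω₁ ≃ Ω₂} {H₁ : HypermapCollection Ω₁} {H₂ : HypermapCollection Ω₂}
    (h₁ : ∀ c, cycleLength H₁.α c ≤ 3) (h₂ : ∀ c, cycleLength H₂.α c ≤ 3)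
    (hσ : PreservesCycles f H₁.σ H₂.σ) (hα : PreservesCycles f H₁.α H₂.α) :
    H₁.numSpanningHypertrees = H₂.numSpanningHypertrees := by
  have r₁ : ∀ {θ}, H₁.IsSpanningHypertree θ → IsSmallRefinement θ H₁.α :=
    fun h => ((H₁.isSpanningHypertree_iff h₁ _).1 h).1
  have r₂ : ∀ {θ}, H₂.IsSpanningHypertree θ → IsSmallRefinement θ H₂.α :=
    fun h => ((H₂.isSpanningHypertree_iff h₂ _).1 h).1
  exact Nat.card_congr
    { toFun := fun θ => ⟨_, θ.2.transfer h₁ h₂ hσ hα (r₁ θ.2)⟩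
      invFun := fun θ => ⟨_, θ.2.transfer h₂ h₁ hσ.symm hα.symm (r₂ θ.2)⟩
      left_inv := fun θ => Subtype.ext ((r₁ θ.2).transfer_symm h₁ hα h₂)
      right_inv := fun θ => Subtype.ext ((r₂ θ.2).transfer_symm h₂ hα.symm h₁) }

/-- An isomorphism of underlying graphs lifts to a bijection between the points. -/
theorem exists_preservesCycles_of_iso {Ω₁ Ω₂ : Type*} [Fintype Ω₁] [Fintype Ω₂]
    {M₁ : HypermapCollection Ω₁} {M₂ : HypermapCollection Ω₂}
    (F : M₁.underlyingGraph.Iso M₂.underlyingGraph) :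
    ∃ f : Ω₁ ≃ Ω₂, PreservesCycles f M₁.σ M₂.σ ∧ PreservesCycles f M₁.α M₂.α := by
  classical
  let p₁ : Ω₁ → Cycles M₂.α × Cycles M₂.σ := fun x =>
    (F.edgeEquiv (cycleAt M₁.α x), F.vertexEquiv (cycleAt M₁.σ x))
  let p₂ : Ω₂ → Cycles M₂.α × Cycles M₂.σ := fun x => (cycleAt M₂.α x, cycleAt M₂.σ x)
  -- The multiplicity of `v` among the ends of an edge counts the points common to both, so
  -- corresponding fibres of `p₁` and `p₂` have equal size.
  have hcard : ∀ c, Fintype.card {x // p₁ x = c} = Fintype.card {x // p₂ x = c} := by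
    rintro ⟨e, v⟩
    have h := congrArg (Multiset.count v) (F.map_ends (F.edgeEquiv.symm e))
    simp only [underlyingGraph, Multiset.map_map, Multiset.count_map, ← Finset.filter_val,
      Finset.card_val, Finset.filter_filter, Function.comp_apply, Equiv.apply_symm_apply] at h
    rw [Fintype.card_subtype, Fintype.card_subtype]
    simpa only [p₁, p₂, Prod.mk.injEq, ← Equiv.eq_symm_apply, eq_comm (a := v)] using h
  let f : Ω₁ ≃ Ω₂ := Equiv.ofFiberEquiv fun c => Fintype.equivOfCardEq (hcard c)
  have hf : ∀ x, p₂ (f x) = p₁ x := Equiv.ofFiberEquiv_map _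
  have hv : ∀ x, cycleAt M₂.σ (f x) = F.vertexEquiv (cycleAt M₁.σ x) :=
    fun x => congrArg Prod.snd (hf x)
  have he : ∀ x, cycleAt M₂.α (f x) = F.edgeEquiv (cycleAt M₁.α x) :=
    fun x => congrArg Prod.fst (hf x)
  refine ⟨f, fun x y => ?_, fun x y => ?_⟩
  · rw [← cycleAt_eq_iff, ← cycleAt_eq_iff, hv, hv, F.vertexEquiv.injective.eq_iff]
  · rw [← cycleAt_eq_iff, ← cycleAt_eq_iff, he, he, F.edgeEquiv.injective.eq_iff]

end HypermapCollection

theorem mainTheorem12 {Ω₁ Ω₂ : Type*} [Fintype Ω₁] [Fintype Ω₂]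
    (M₁ : HypermapCollection Ω₁) (M₂ : HypermapCollection Ω₂)
    (hM₁ : M₁.IsMap) (hM₂ : M₂.IsMap)
    (hdeg₁ : ∀ v, M₁.degree v ≤ 3) (hdeg₂ : ∀ v, M₂.degree v ≤ 3)
    (hG : Nonempty (M₁.underlyingGraph.Iso M₂.underlyingGraph)) :
    M₁.reciprocal.numSpanningHypertrees = M₂.reciprocal.numSpanningHypertrees := by
  obtain ⟨F⟩ := hG
  obtain ⟨f, hσ, hα⟩ := HypermapCollection.exists_preservesCycles_of_iso F
  -- Reciprocity swaps the roles: the degree bounds become bounds on hyperedges, and `hα`, `hσ`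
  -- change places.
  exact HypermapCollection.numSpanningHypertrees_eq_of_preservesCycles hdeg₁ hdeg₂ hα hσ
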